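/- For an elliptic curve $E$ over $\bar{\mathbb Q}$, let $E[2]$ be its $2$-torsion subgroup, $E[\infty]$ the set of all its torsion points, and call a degree-two morphism $\pi:E\to\mathbb P^1$ that identifies $P$ with $-P$ a standard double cover (equivalently, $\pi$ is the $x$-coordinate of a Weierstrass equation followed by an automorphism of $\mathbb P^1$). For $a,b,c,d\in\mathbb P^1(\bar{\mathbb Q})$ distinct, let $L[a,b,c,d]$ be the smallest subset $L$ of $\mathbb P^1(\bar{\mathbb Q})=\bar{\mathbb Q}\cup\{\infty\}$ that contains $a,b,c,d$ and has the following property: for every elliptic curve $E$ over $\bar{\mathbb Q}$ and every standard double cover $\pi:E\to\mathbb P^1$, if $\pi(E[2])\subseteq L$, then $\pi(E[\infty])\subseteq L$. For $\delta\in\bar{\mathbb Q}\setminus\{0,\pm1,\pm i\}$ put $L_\delta=L[\delta,-\delta,\delta^{-1},-\delta^{-1}]$. Corollary 7. Let $\delta\in\bar{\mathbb Q}\setminus\{0,\pm1,\pm i\}$, and let $p\in\bar{\mathbb Q}[x]$ be a polynomial of degree $2$, $3$ or $4$ all of whose coefficients lie in $L_\delta\setminus\{\infty\}$. Then all $\deg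 p$ roots of $p$ in $\bar{\mathbb Q}$, counted with multiplicity, lie in $L_\delta\setminus\{\infty\}$. -/

import Mathlib

/-- The field of algebraic numbers. -/
abbrev Qbar : Type := AlgebraicClosure ℚ

/-- The projective line over the algebraic numbers, written as the affine line together with the
point `∞`. The group `GL (Fin 2) Qbar` acts on it by fractional linear transformations. -/
abbrev P1 : Type := OnePoint Qbar

/-- The `x`-coordinate of a point of a Weierstrass curve, as a point of the projective line; the
point at infinity (the zero of the group law) goes to `∞`. -/
def xCoord (W : WeierstrassCurve Qbar) : W.toAffine.Point → P1
  | .zero => OnePoint.infty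
  | .some x _ _ => (x : P1)

open scoped Classical in
/-- The double cover `E → ℙ¹` identifying `P` with `-P`, for the elliptic curve `E` with Weierstrass
equation `W`, in the coordinate of `ℙ¹` given by `g`. Every morphism `E → ℙ¹` of degree two that
identifies `P` with `-P` is of this form; the models `y² = quartic` of elliptic curves with the
projection to `x` are included in this way. -/
noncomputable def doubleCover (W : WeierstrassCurve Qbar) (g : GL (Fin 2) Qbar) (P : W.toAffine.Point) : P1 :=
  g • xCoord W P

open scoped Classical in
/-- The image of the `2`-torsion subgroup `E[2]` under the double cover. -/
def image2Torsion (W : WeierstrassCurve Qbar) (g : GL (Fin 2) Qbar) : Set P1 :=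
  doubleCover W g '' {P | 2 • P = 0}

open scoped Classical in
/-- The image of the set `E[∞]` of all torsion points under the double cover. -/
def imageTorsion (W : WeierstrassCurve Qbar) (g : GL (Fin 2) Qbar) : Set P1 :=
  doubleCover W g '' {P | ∃ n : ℕ, 0 < n ∧ n • P = 0}

/-- A subset `S` of the projective line is torsion closed if `π(E[2]) ⊆ S` implies
`π(E[∞]) ⊆ S` for every elliptic curve `E` with double cover `π : E → ℙ¹`. -/
def IsTorsionClosed (S : Set P1) : Prop :=
  ∀ (W : WeierstrassCurve Qbar) [W.IsElliptic] (g : GL (Fin 2) Qbar),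
    image2Torsion W g ⊆ S → imageTorsion W g ⊆ S

/-- `L[a, b, c, d]`: the smallest torsion closed subset of the projective line that contains
`a, b, c, d`. -/
def torsionHull (a b c d : P1) : Set P1 :=
  ⋂₀ {S : Set P1 | {a, b, c, d} ⊆ S ∧ IsTorsionClosed S}

/-- `torsionHull a b c d` is indeed the least such set. -/
theorem torsionHull_isLeast (a b c d : P1) :
    IsLeast {S : Set P1 | {a, b, c, d} ⊆ S ∧ IsTorsionClosed S} (torsionHull a b c d) := by
  refine ⟨⟨Set.subset_sInter fun S hS => hS.1, ?_⟩, fun S hS => Set.sInter_subset_of_mem hS⟩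
  intro W _ g h
  exact Set.subset_sInter fun S hS => hS.2 W g (h.trans (Set.sInter_subset_of_mem hS))

/-- `L_δ = L[δ, -δ, 1/δ, -1/δ]`. -/
def LDelta (δ : Qbar) : Set P1 :=
  torsionHull (δ : P1) ((-δ : Qbar) : P1) ((δ⁻¹ : Qbar) : P1) ((-δ⁻¹ : Qbar) : P1)

/-! The affine part of `LDelta δ` is a subfield of `Qbar` closed under square and cube roots, so the
formulas of Cardano and Ferrari keep the roots of polynomials of degree at most four inside it. Only
3- and 4-torsion is used. Images of 4-torsion points are fixed points of the involutions of ℙ¹ that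
permute the four branch points in pairs (`add_sqrt_mem`, `fixedPoint_mem`). They give 0, ∞, ±1 and
square roots of products. Minimality of a hull turns Möbius symmetries of the generators into
symmetries of the hull, hence the closure properties collected in `IsBalanced`. Fixed points then
yield z ↦ z + 1 (`add_one`), z ↦ z + 1/z (`add_inv`) and squaring (`sq`); sums and products follow.
Cube roots come from the resolvent cubic of the 3-division polynomial (`exists_cube_root`). -/

/-! ### Torsion of order three and four on split Weierstrass curves. -/

section TorsionClosure

open scoped Classical

/-- The Weierstrass curve `y² = (x - e₁)(x - e₂)(x - e₃)`. -/
noncomputable def splitCurve (e₁ e₂ e₃ : Qbar) : WeierstrassCurve Qbar :=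
  ⟨0, -(e₁ + e₂ + e₃), 0, e₁ * e₂ + e₁ * e₃ + e₂ * e₃, -(e₁ * e₂ * e₃)⟩

theorem splitCurve_isElliptic {e₁ e₂ e₃ : Qbar} (h₁₂ : e₁ ≠ e₂) (h₁₃ : e₁ ≠ e₃) (h₂₃ : e₂ ≠ e₃) :
    (splitCurve e₁ e₂ e₃).IsElliptic := by
  have h : (splitCurve e₁ e₂ e₃).Δ = 16 * ((e₁ - e₂) * (e₁ - e₃) * (e₂ - e₃)) ^ 2 := by
    simp only [splitCurve, WeierstrassCurve.Δ, WeierstrassCurve.b₂, WeierstrassCurve.b₄,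
      WeierstrassCurve.b₆, WeierstrassCurve.b₈]
    ring
  refine ⟨isUnit_iff_ne_zero.mpr ?_⟩
  rw [h]
  have := sub_ne_zero.mpr h₁₂
  have := sub_ne_zero.mpr h₁₃
  have := sub_ne_zero.mpr h₂₃
  exact mul_ne_zero (by norm_num) (pow_ne_zero 2 (by simp_all))

theorem splitCurve_equation_iff {e₁ e₂ e₃ x y : Qbar} :
    (splitCurve e₁ e₂ e₃).toAffine.Equation x y ↔ y ^ 2 = (x - e₁) * (x - e₂) * (x - e₃) := by
  rw [WeierstrassCurve.Affine.equation_iff]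
  simp only [splitCurve]
  constructor <;> intro h <;> linear_combination h

theorem splitCurve_negY {e₁ e₂ e₃ x y : Qbar} :
    (splitCurve e₁ e₂ e₃).toAffine.negY x y = -y := by
  simp [WeierstrassCurve.Affine.negY, splitCurve]

theorem splitCurve_two_nsmul_eq_zero_iff {e₁ e₂ e₃ x y : Qbar}
    (h : (splitCurve e₁ e₂ e₃).toAffine.Nonsingular x y) :
    2 • WeierstrassCurve.Affine.Point.some x y h = 0 ↔ y = 0 := by
  rw [two_nsmul]
  constructor
  · intro h0
    by_contra hy
    have hne : y ≠ (splitCurve e₁ e₂ e₃).toAffine.negY x y := by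
      rw [splitCurve_negY]
      exact fun h ↦ hy (self_eq_neg.mp h)
    rw [WeierstrassCurve.Affine.Point.add_self_of_Y_ne hne] at h0
    exact WeierstrassCurve.Affine.Point.some_ne_zero _ h0
  · rintro rfl
    exact WeierstrassCurve.Affine.Point.add_self_of_Y_eq (by rw [splitCurve_negY, neg_zero])

theorem splitCurve_image2Torsion_subset {e₁ e₂ e₃ : Qbar} {S : Set P1}
    (h0 : OnePoint.infty ∈ S) (h₁ : (e₁ : P1) ∈ S) (h₂ : (e₂ : P1) ∈ S) (h₃ : (e₃ : P1) ∈ S) :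
    image2Torsion (splitCurve e₁ e₂ e₃) 1 ⊆ S := by
  rintro _ ⟨P, hP, rfl⟩
  cases P with
  | zero => simpa [doubleCover, xCoord] using h0
  | some x y h =>
    have hy := (splitCurve_two_nsmul_eq_zero_iff h).mp hP
    have he := splitCurve_equation_iff.mp h.1
    rw [hy, zero_pow two_ne_zero, eq_comm, mul_eq_zero, mul_eq_zero, sub_eq_zero, sub_eq_zero,
      sub_eq_zero] at he
    simp only [doubleCover, xCoord, one_smul]
    rcases he with (rfl | rfl) | rfl <;> assumption

/-- The doubling formula: either `P` is `2`-torsion, or `2P` is affine with known abscissa. -/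
theorem splitCurve_two_nsmul {e₁ e₂ e₃ x y : Qbar}
    (h : (splitCurve e₁ e₂ e₃).toAffine.Nonsingular x y) (hy : y ≠ 0) :
    ∃ (X Y : Qbar) (hX : (splitCurve e₁ e₂ e₃).toAffine.Nonsingular X Y),
      2 • WeierstrassCurve.Affine.Point.some x y h = .some X Y hX ∧
      4 * y ^ 2 * (X - (e₁ + e₂ + e₃) + 2 * x) =
        (3 * x ^ 2 - 2 * (e₁ + e₂ + e₃) * x + (e₁ * e₂ + e₁ * e₃ + e₂ * e₃)) ^ 2 := by
  have hne : y ≠ (splitCurve e₁ e₂ e₃).toAffine.negY x y := by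
    rw [splitCurve_negY]
    exact fun h ↦ hy (self_eq_neg.mp h)
  refine ⟨_, _, _, (two_nsmul _).trans (WeierstrassCurve.Affine.Point.add_self_of_Y_ne hne), ?_⟩
  rw [WeierstrassCurve.Affine.slope_of_Y_ne rfl hne, splitCurve_negY]
  simp only [WeierstrassCurve.Affine.addX, splitCurve]
  have : y - -y ≠ 0 := by
    rw [sub_neg_eq_add, ← two_mul]
    exact mul_ne_zero two_ne_zero hy
  field_simp
  ring

theorem mem_of_torsion {S : Set P1} (hS : IsTorsionClosed S) {e₁ e₂ e₃ x : Qbar}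
    (h0 : OnePoint.infty ∈ S) (h₁ : (e₁ : P1) ∈ S) (h₂ : (e₂ : P1) ∈ S) (h₃ : (e₃ : P1) ∈ S)
    (h₁₂ : e₁ ≠ e₂) (h₁₃ : e₁ ≠ e₃) (h₂₃ : e₂ ≠ e₃)
    (hx : ∀ y (h : (splitCurve e₁ e₂ e₃).toAffine.Nonsingular x y), y ≠ 0 →
      ∃ n : ℕ, 0 < n ∧ n • WeierstrassCurve.Affine.Point.some x y h = 0) :
    (x : P1) ∈ S := by
  have hE := splitCurve_isElliptic h₁₂ h₁₃ h₂₃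
  obtain ⟨y, hy⟩ := IsAlgClosed.exists_pow_nat_eq ((x - e₁) * (x - e₂) * (x - e₃)) two_pos
  have hns : (splitCurve e₁ e₂ e₃).toAffine.Nonsingular x y :=
    WeierstrassCurve.Affine.equation_iff_nonsingular.mp (splitCurve_equation_iff.mpr hy)
  have hsub := hS (splitCurve e₁ e₂ e₃) 1 (splitCurve_image2Torsion_subset h0 h₁ h₂ h₃)
  have hmem : doubleCover (splitCurve e₁ e₂ e₃) 1 (.some x y hns) ∈ S := by
    refine hsub ⟨_, ?_, rfl⟩
    by_cases hy0 : y = 0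
    · exact ⟨2, two_pos, (splitCurve_two_nsmul_eq_zero_iff hns).mpr hy0⟩
    · exact hx y hns hy0
  simpa [doubleCover, xCoord] using hmem

/-- Abscissas of points of order four. -/
theorem add_sqrt_mem {S : Set P1} (hS : IsTorsionClosed S) {a c d r : Qbar}
    (h0 : OnePoint.infty ∈ S) (ha : (a : P1) ∈ S) (hc : (c : P1) ∈ S) (hd : (d : P1) ∈ S)
    (hac : a ≠ c) (had : a ≠ d) (hcd : c ≠ d) (hr : r ^ 2 = (c - a) * (d - a)) :
    ((a + r : Qbar) : P1) ∈ S := by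
  refine mem_of_torsion hS h0 ha hc hd hac had hcd fun y h hy ↦ ?_
  obtain ⟨X, Y, hX, h2, hf⟩ := splitCurve_two_nsmul h hy
  have he := splitCurve_equation_iff.mp h.1
  have hXa : X = a := by
    refine sub_eq_zero.mp ((mul_eq_zero_iff_left (pow_ne_zero 2 hy)).mp ?_)
    have h4 : (4 : Qbar) ≠ 0 := by norm_num
    refine (mul_eq_zero_iff_left h4).mp ?_
    have hrr : r ^ 2 - (c - a) * (d - a) = 0 := sub_eq_zero.mpr hr
    -- In general X(2P) - a = ((x - a)² - (c - a)(d - a))² / (4y²), so the choice of r makes 2P the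
    -- 2-torsion point (a, 0).
    have key : 4 * ((X - a) * y ^ 2) = (r ^ 2 - (c - a) * (d - a)) ^ 2 := by
      linear_combination hf - 4 * (a - (a + c + d) + 2 * (a + r)) * he
    linear_combination key + (r ^ 2 - (c - a) * (d - a)) * hrr
  have hY : Y = 0 := by
    have := splitCurve_equation_iff.mp hX.1
    rw [hXa, sub_self, zero_mul, zero_mul] at this
    exact pow_eq_zero_iff two_ne_zero |>.mp this
  refine ⟨2 * 2, by norm_num, ?_⟩
  rw [mul_nsmul, h2, splitCurve_two_nsmul_eq_zero_iff, hY]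

/-- Abscissas of points of order three on `y² = x (x - 1) (x - l)`. -/
theorem three_torsion_mem {S : Set P1} (hS : IsTorsionClosed S) {l x : Qbar}
    (hinf : OnePoint.infty ∈ S) (h0 : ((0 : Qbar) : P1) ∈ S) (h1 : ((1 : Qbar) : P1) ∈ S)
    (hl : (l : P1) ∈ S) (hl0 : l ≠ 0) (hl1 : l ≠ 1)
    (hx : 3 * x ^ 4 - 4 * (1 + l) * x ^ 3 + 6 * l * x ^ 2 - l ^ 2 = 0) : (x : P1) ∈ S := by
  refine mem_of_torsion hS hinf h0 h1 hl zero_ne_one hl0.symm hl1.symm fun y h hy ↦ ?_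
  obtain ⟨X, Y, hX, h2, hf⟩ := splitCurve_two_nsmul h hy
  have he := splitCurve_equation_iff.mp h.1
  have hXx : X = x := by
    refine sub_eq_zero.mp ((mul_eq_zero_iff_left (pow_ne_zero 2 hy)).mp ?_)
    refine (mul_eq_zero_iff_left (show (4 : Qbar) ≠ 0 by norm_num)).mp ?_
    linear_combination hf - 4 * (3 * x - (0 + 1 + l)) * he - hx
  subst hXx
  have hP : ∀ P Q : (splitCurve 0 1 l).toAffine.Point, P = Q ∨ P = -Q → 2 • Q = P →
      (3 • Q = 0 ∨ 1 • Q = 0) := by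
    rintro P Q (rfl | rfl) hPQ
    · right
      rwa [two_nsmul, add_eq_left, ← one_nsmul P] at hPQ
    · left
      rw [show 3 = 2 + 1 from rfl, add_nsmul, hPQ, one_nsmul, neg_add_cancel]
  -- 2P and P share an abscissa, so 2P = ±P.
  have hor := WeierstrassCurve.Affine.Point.X_eq_iff (h₁ := hX) (h₂ := h) |>.mp rfl
  rcases hP _ _ hor h2 with h | h
  · exact ⟨3, by norm_num, h⟩
  · exact ⟨1, by norm_num, h⟩

end TorsionClosure

/-! ### Transport by Möbius transformations. -/

section Moebius

open scoped Classical

theorem IsTorsionClosed.preimage {S : Set P1} (hS : IsTorsionClosed S) (g : GL (Fin 2) Qbar) :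
    IsTorsionClosed {z | g • z ∈ S} := by
  intro W _ k hk
  have h : ∀ P, doubleCover W (g * k) P = g • doubleCover W k P := fun P ↦ mul_smul _ _ _
  have h' := hS W (g * k) (by
    rintro _ ⟨P, hP, rfl⟩
    rw [h]
    exact hk ⟨P, hP, rfl⟩)
  rintro _ ⟨P, hP, rfl⟩
  have := h' ⟨P, hP, rfl⟩
  rwa [h] at this

theorem isTorsionClosed_torsionHull (a b c d : P1) : IsTorsionClosed (torsionHull a b c d) :=
  (torsionHull_isLeast a b c d).1.2

theorem smul_mem_of_mem_torsionHull {S : Set P1} (hS : IsTorsionClosed S) {a b c d z : P1}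
    (g : GL (Fin 2) Qbar) (ha : g • a ∈ S) (hb : g • b ∈ S) (hc : g • c ∈ S) (hd : g • d ∈ S)
    (hz : z ∈ torsionHull a b c d) : g • z ∈ S := by
  refine (torsionHull_isLeast a b c d).2 ⟨?_, hS.preimage g⟩ hz
  rintro x (rfl | rfl | rfl | rfl) <;> assumption

theorem mem_torsionHull (a b c d : P1) :
    a ∈ torsionHull a b c d ∧ b ∈ torsionHull a b c d ∧ c ∈ torsionHull a b c d ∧
      d ∈ torsionHull a b c d := by
  have h := (torsionHull_isLeast a b c d).1.1
  exact ⟨h (by simp), h (by simp), h (by simp), h (by simp)⟩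

/-- The homothety `z ↦ t z`. -/
noncomputable def homothety (t : Qbar) (ht : t ≠ 0) : GL (Fin 2) Qbar :=
  Matrix.GeneralLinearGroup.mkOfDetNeZero !![t, 0; 0, 1] (by simpa using ht)

theorem homothety_smul_infty (t : Qbar) (ht : t ≠ 0) :
    homothety t ht • (OnePoint.infty : P1) = OnePoint.infty := by
  rw [OnePoint.smul_infty_eq_self_iff]
  simp [homothety, Matrix.GeneralLinearGroup.mkOfDetNeZero]

theorem homothety_smul_coe (t : Qbar) (ht : t ≠ 0) (z : Qbar) :
    homothety t ht • (z : P1) = ((t * z : Qbar) : P1) := by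
  rw [OnePoint.smul_some_eq_ite]
  simp [homothety, Matrix.GeneralLinearGroup.mkOfDetNeZero]

/-- The transformation `z ↦ b + 1 / z`. -/
noncomputable def invShift (b : Qbar) : GL (Fin 2) Qbar :=
  Matrix.GeneralLinearGroup.mkOfDetNeZero !![b, 1; 1, 0] (by simp)

theorem invShift_smul_infty (b : Qbar) : invShift b • (OnePoint.infty : P1) = (b : P1) := by
  rw [OnePoint.smul_infty_eq_ite]
  simp [invShift, Matrix.GeneralLinearGroup.mkOfDetNeZero]

theorem invShift_smul_zero (b : Qbar) :
    invShift b • ((0 : Qbar) : P1) = OnePoint.infty := by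
  rw [OnePoint.smul_some_eq_ite]
  simp [invShift, Matrix.GeneralLinearGroup.mkOfDetNeZero]

theorem invShift_smul_coe (b : Qbar) {z : Qbar} (hz : z ≠ 0) :
    invShift b • (z : P1) = ((b + z⁻¹ : Qbar) : P1) := by
  rw [OnePoint.smul_some_eq_ite]
  simp only [invShift, Matrix.GeneralLinearGroup.mkOfDetNeZero]
  simp [hz]
  field_simp

theorem invShift_smul_inv_sub {b z : Qbar} (hz : z ≠ b) :
    invShift b • (((z - b)⁻¹ : Qbar) : P1) = (z : P1) := by
  rw [invShift_smul_coe b (inv_ne_zero (sub_ne_zero.mpr hz)), inv_inv, add_sub_cancel]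

/-- The fixed points of the involution exchanging `a` with `b` and `c` with `d`. -/
theorem fixedPoint_mem {S : Set P1} (hS : IsTorsionClosed S) {a b c d x : Qbar}
    (ha : (a : P1) ∈ S) (hb : (b : P1) ∈ S) (hc : (c : P1) ∈ S) (hd : (d : P1) ∈ S)
    (hab : a ≠ b) (hac : a ≠ c) (had : a ≠ d) (hbc : b ≠ c) (hbd : b ≠ d) (hcd : c ≠ d)
    (hx : (a + b - c - d) * x ^ 2 - 2 * (a * b - c * d) * x
      + (a * b * (c + d) - c * d * (a + b)) = 0) : (x : P1) ∈ S := by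
  have hb0 : b - a ≠ 0 := sub_ne_zero.mpr hab.symm
  have hbc0 : b - c ≠ 0 := sub_ne_zero.mpr hbc
  have hbd0 : b - d ≠ 0 := sub_ne_zero.mpr hbd
  have hxb : x ≠ b := by
    rintro rfl
    refine mul_ne_zero (mul_ne_zero hb0 hbc0) hbd0 ?_
    linear_combination hx
  have hab0 : a - b ≠ 0 := sub_ne_zero.mpr hab
  have hcb0 : c - b ≠ 0 := sub_ne_zero.mpr hbc.symm
  have hdb0 : d - b ≠ 0 := sub_ne_zero.mpr hbd.symm
  have hxb0 : x - b ≠ 0 := sub_ne_zero.mpr hxb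
  have hinj : ∀ {u v : Qbar}, u ≠ v → (u - b)⁻¹ ≠ (v - b)⁻¹ := fun huv h ↦
    huv (sub_left_inj.mp (inv_injective h))
  -- Sending b to ∞ reduces to the involution exchanging ∞ with a' and c' with d', whose fixed
  -- points are a' ± √((c' - a')(d' - a')).
  have key := add_sqrt_mem (hS.preimage (invShift b))
    (a := (a - b)⁻¹) (c := (c - b)⁻¹) (d := (d - b)⁻¹) (r := (x - b)⁻¹ - (a - b)⁻¹)
    (by simpa only [Set.mem_ofPred_eq, invShift_smul_infty] using hb)
    (by simpa only [Set.mem_ofPred_eq, invShift_smul_inv_sub hab] using ha)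
    (by simpa only [Set.mem_ofPred_eq, invShift_smul_inv_sub hbc.symm] using hc)
    (by simpa only [Set.mem_ofPred_eq, invShift_smul_inv_sub hbd.symm] using hd)
    (hinj hac) (hinj had) (hinj hcd) (by
      field_simp
      linear_combination (b - a) * hx)
  rwa [add_sub_cancel, Set.mem_ofPred_eq, invShift_smul_inv_sub hxb] at key

/-- Here the involution of `fixedPoint_mem` is z ↦ a + b - z, which fixes ∞; in the coordinate 1/(z
- b) this fixed point is 0, whence the value of r. -/
theorem infty_mem_of_add_eq {S : Set P1} (hS : IsTorsionClosed S) {a b c d : Qbar}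
    (ha : (a : P1) ∈ S) (hb : (b : P1) ∈ S) (hc : (c : P1) ∈ S) (hd : (d : P1) ∈ S)
    (hab : a ≠ b) (hac : a ≠ c) (had : a ≠ d) (hbc : b ≠ c) (hbd : b ≠ d) (hcd : c ≠ d)
    (h : a + b = c + d) : OnePoint.infty ∈ S := by
  have hab0 : a - b ≠ 0 := sub_ne_zero.mpr hab
  have hcb0 : c - b ≠ 0 := sub_ne_zero.mpr hbc.symm
  have hdb0 : d - b ≠ 0 := sub_ne_zero.mpr hbd.symm
  have hinj : ∀ {u v : Qbar}, u ≠ v → (u - b)⁻¹ ≠ (v - b)⁻¹ := fun huv h ↦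
    huv (sub_left_inj.mp (inv_injective h))
  have key := add_sqrt_mem (hS.preimage (invShift b))
    (a := (a - b)⁻¹) (c := (c - b)⁻¹) (d := (d - b)⁻¹) (r := -(a - b)⁻¹)
    (by simpa only [Set.mem_ofPred_eq, invShift_smul_infty] using hb)
    (by simpa only [Set.mem_ofPred_eq, invShift_smul_inv_sub hab] using ha)
    (by simpa only [Set.mem_ofPred_eq, invShift_smul_inv_sub hbc.symm] using hc)
    (by simpa only [Set.mem_ofPred_eq, invShift_smul_inv_sub hbd.symm] using hd)
    (hinj hac) (hinj had) (hinj hcd) (by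
      obtain rfl : a = c + d - b := eq_sub_of_add_eq h
      field_simp
      ring)
  rwa [add_neg_cancel, Set.mem_ofPred_eq, invShift_smul_zero] at key

end Moebius

/-! ### Balanced sets: `baseHull` and `LDelta δ`. -/

/-- The torsion hull of `∞, 0, 1, -1`, contained in every `LDelta δ`. -/
def baseHull : Set P1 :=
  torsionHull OnePoint.infty ((0 : Qbar) : P1) ((1 : Qbar) : P1) ((-1 : Qbar) : P1)

/-- Torsion closed sets through `∞, 0, 1` that are stable under negation, inversion and
multiplication by elements of `baseHull`. -/
structure IsBalanced (S : Set P1) : Prop where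
  closed : IsTorsionClosed S
  infty : OnePoint.infty ∈ S
  zero : ((0 : Qbar) : P1) ∈ S
  one : ((1 : Qbar) : P1) ∈ S
  neg : ∀ {z : Qbar}, (z : P1) ∈ S → ((-z : Qbar) : P1) ∈ S
  inv : ∀ {z : Qbar}, (z : P1) ∈ S → ((z⁻¹ : Qbar) : P1) ∈ S
  smul : ∀ {t z : Qbar}, (t : P1) ∈ baseHull → (z : P1) ∈ S → ((t * z : Qbar) : P1) ∈ S

/-- The homothety by t carries the generators ∞, 0, 1, -1 of `baseHull` to ∞, 0, t, -t. -/
theorem mul_mem_of_mem_baseHull {S : Set P1} (hS : IsTorsionClosed S)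
    (hinf : OnePoint.infty ∈ S) (h0 : ((0 : Qbar) : P1) ∈ S) {t z : Qbar}
    (ht : (t : P1) ∈ S) (ht' : ((-t : Qbar) : P1) ∈ S) (hz : (z : P1) ∈ baseHull) :
    ((t * z : Qbar) : P1) ∈ S := by
  classical
  by_cases ht0 : t = 0
  · rwa [ht0, zero_mul]
  rw [← homothety_smul_coe t ht0]
  refine smul_mem_of_mem_torsionHull hS (homothety t ht0) ?_ ?_ ?_ ?_ hz
  · rwa [homothety_smul_infty]
  · rwa [homothety_smul_coe, mul_zero]
  · rwa [homothety_smul_coe, mul_one]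
  · rwa [homothety_smul_coe, mul_neg_one]

theorem isBalanced_baseHull : IsBalanced baseHull := by
  classical
  have hc : IsTorsionClosed baseHull := isTorsionClosed_torsionHull _ _ _ _
  obtain ⟨hinf, h0, h1, h1'⟩ : _ ∧ _ ∧ _ ∧ _ :=
    mem_torsionHull OnePoint.infty ((0 : Qbar) : P1) ((1 : Qbar) : P1) ((-1 : Qbar) : P1)
  have hneg : ∀ {z : Qbar}, (z : P1) ∈ baseHull → ((-z : Qbar) : P1) ∈ baseHull := by
    intro z hz
    rw [← neg_one_mul]
    exact mul_mem_of_mem_baseHull hc hinf h0 h1' (by rwa [neg_neg]) hz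
  refine ⟨hc, hinf, h0, h1, hneg, fun {z} hz ↦ ?_, fun {t z} ht hz ↦
    mul_mem_of_mem_baseHull hc hinf h0 ht (hneg ht) hz⟩
  by_cases hz0 : z = 0
  · rwa [hz0, inv_zero]
  rw [← zero_add z⁻¹, ← invShift_smul_coe 0 hz0]
  refine smul_mem_of_mem_torsionHull hc (invShift 0) ?_ ?_ ?_ ?_ hz
  · rwa [invShift_smul_infty]
  · rwa [invShift_smul_zero]
  · rwa [invShift_smul_coe 0 one_ne_zero, inv_one, zero_add]
  · rwa [invShift_smul_coe 0 (neg_ne_zero.mpr one_ne_zero), inv_neg_one, zero_add]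

theorem isBalanced_LDelta {δ : Qbar} (hδ0 : δ ≠ 0) (hδ4 : δ ^ 4 ≠ 1) :
    IsBalanced (LDelta δ) := by
  classical
  have hc : IsTorsionClosed (LDelta δ) := isTorsionClosed_torsionHull _ _ _ _
  obtain ⟨ha, hb, hc', hd⟩ : _ ∧ _ ∧ _ ∧ _ :=
    mem_torsionHull (δ : P1) ((-δ : Qbar) : P1) ((δ⁻¹ : Qbar) : P1) ((-δ⁻¹ : Qbar) : P1)
  change _ ∈ LDelta δ at ha hb hc' hd
  have hn : ∀ {u : Qbar}, u ≠ 0 → u ≠ -u := fun hu h ↦ hu (self_eq_neg.mp h)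
  have hi : δ⁻¹ ≠ 0 := inv_ne_zero hδ0
  have h2 : δ ≠ δ⁻¹ := by
    intro h
    have : δ * δ = 1 := by nth_rw 2 [h]; exact mul_inv_cancel₀ hδ0
    exact hδ4 (by linear_combination (δ * δ + 1) * this)
  have h3 : δ ≠ -δ⁻¹ := by
    intro h
    have : δ * δ = -1 := by nth_rw 2 [h]; rw [mul_neg, mul_inv_cancel₀ hδ0]
    exact hδ4 (by linear_combination (δ * δ - 1) * this)
  have h4 : -δ ≠ δ⁻¹ := fun h ↦ h3 (by rw [← h, neg_neg])
  have h5 : -δ ≠ -δ⁻¹ := fun h ↦ h2 (neg_injective h)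
  -- The involution z ↦ -z pairs the generators and fixes ∞ and 0; z ↦ 1/z pairs them too and fixes
  -- ±1.
  have hinf : OnePoint.infty ∈ LDelta δ :=
    infty_mem_of_add_eq hc ha hb hc' hd (hn hδ0) h2 h3 h4 h5 (hn hi) (by ring)
  have h0 : ((0 : Qbar) : P1) ∈ LDelta δ :=
    fixedPoint_mem hc ha hb hc' hd (hn hδ0) h2 h3 h4 h5 (hn hi) (by ring)
  have h1 : ∀ e : Qbar, e ^ 2 = 1 → (e : P1) ∈ LDelta δ := fun e he ↦
    fixedPoint_mem hc ha hc' hb hd h2 (hn hδ0) h3 h4.symm (hn hi) h5 (by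
      linear_combination 2 * (δ + δ⁻¹) * he - 2 * (δ + δ⁻¹) * mul_inv_cancel₀ hδ0)
  have hneg : ∀ {z : Qbar}, (z : P1) ∈ LDelta δ → ((-z : Qbar) : P1) ∈ LDelta δ := by
    intro z hz
    have h : (-1 : Qbar) ≠ 0 := neg_ne_zero.mpr one_ne_zero
    rw [← neg_one_mul, ← homothety_smul_coe _ h]
    refine smul_mem_of_mem_torsionHull hc (homothety (-1) h) ?_ ?_ ?_ ?_ hz <;>
      rw [homothety_smul_coe, neg_one_mul]
    · exact hb
    · rwa [neg_neg]
    · exact hd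
    · rwa [neg_neg]
  refine ⟨hc, hinf, h0, h1 1 (by ring), hneg, fun {z} hz ↦ ?_, fun {t z} ht hz ↦ ?_⟩
  · by_cases hz0 : z = 0
    · rwa [hz0, inv_zero]
    rw [← zero_add z⁻¹, ← invShift_smul_coe 0 hz0]
    refine smul_mem_of_mem_torsionHull hc (invShift 0) ?_ ?_ ?_ ?_ hz
    · rwa [invShift_smul_coe 0 hδ0, zero_add]
    · rwa [invShift_smul_coe 0 (neg_ne_zero.mpr hδ0), zero_add, inv_neg]
    · rwa [invShift_smul_coe 0 hi, zero_add, inv_inv]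
    · rwa [invShift_smul_coe 0 (neg_ne_zero.mpr hi), zero_add, inv_neg, inv_inv]
  · rw [mul_comm]
    exact mul_mem_of_mem_baseHull hc hinf h0 hz (hneg hz) ht

/-! ### Field operations on a balanced set. -/

namespace IsBalanced

variable {S : Set P1}

/-- For distinct nonzero a and b this is 4-torsion over the branch points ∞, 0, a, b. -/
theorem sqrt_mul (hS : IsBalanced S) {a b r : Qbar} (ha : (a : P1) ∈ S) (hb : (b : P1) ∈ S)
    (hr : r ^ 2 = a * b) : (r : P1) ∈ S := by
  by_cases hab : a = b
  · rw [← hab, ← sq, sq_eq_sq_iff_eq_or_eq_neg] at hr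
    rcases hr with rfl | rfl
    · exact ha
    · exact hS.neg ha
  by_cases hr0 : r = 0
  · rw [hr0]
    exact hS.zero
  have hab0 : a * b ≠ 0 := hr ▸ pow_ne_zero 2 hr0
  have := add_sqrt_mem hS.closed (r := r) hS.infty hS.zero ha hb
    (left_ne_zero_of_mul hab0).symm (right_ne_zero_of_mul hab0).symm hab (by simpa using hr)
  rwa [zero_add] at this

theorem of_mem_baseHull (hS : IsBalanced S) {t : Qbar} (ht : (t : P1) ∈ baseHull) :
    (t : P1) ∈ S := by
  simpa using hS.smul ht hS.one

/-- α = -1 + √2 arises from the branch points ∞, -1, 1, 0; its equation is what `rotate` needs. -/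
theorem exists_translation : ∃ α : Qbar, (α : P1) ∈ baseHull ∧ α ^ 2 + 2 * α - 1 = 0 := by
  obtain ⟨s, hs⟩ := IsAlgClosed.exists_pow_nat_eq (2 : Qbar) two_pos
  have h := isBalanced_baseHull
  have h1 : (-1 : Qbar) ≠ 1 := fun h ↦ one_ne_zero (self_eq_neg.mp h.symm)
  refine ⟨-1 + s, ?_, by linear_combination hs⟩
  exact add_sqrt_mem h.closed h.infty (h.neg h.one) h.one h.zero h1
    (neg_ne_zero.mpr one_ne_zero) one_ne_zero (by linear_combination hs)

/-- Fixed points of the involution exchanging `z⁻¹` with `-1` and `1` with `z`. -/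
theorem rotate (hS : IsBalanced S) {α z : Qbar} (hα : (α : P1) ∈ baseHull)
    (hα2 : α ^ 2 + 2 * α - 1 = 0) (hz : (z : P1) ∈ S) (hz' : α * z + 1 ≠ 0) :
    (((z + α) / (α * z + 1) : Qbar) : P1) ∈ S := by
  by_cases hz0 : z = 0
  · simpa [hz0] using hS.of_mem_baseHull hα
  by_cases hz1 : z = 1
  · subst hz1
    rw [mul_one, add_comm, div_self (by rwa [mul_one] at hz')]
    exact hS.one
  by_cases hz2 : z = -1
  · subst hz2
    rw [show (-1 + α) / (α * -1 + 1) = (-1 : Qbar) by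
      rw [div_eq_iff hz']
      ring]
    exact hS.neg hS.one
  have hzz : z⁻¹ ≠ z := by
    intro h
    have : z * z = 1 := by nth_rw 2 [← h]; exact mul_inv_cancel₀ hz0
    rcases mul_self_eq_one_iff.mp this with h | h
    · exact hz1 h
    · exact hz2 h
  refine fixedPoint_mem hS.closed (hS.inv hz) (hS.neg hS.one) hS.one hz
    (fun h ↦ hz2 ?_) (fun h ↦ hz1 (inv_eq_one.mp h)) hzz
    (fun h ↦ one_ne_zero (self_eq_neg.mp h.symm)) (fun h ↦ hz2 h.symm) (fun h ↦ hz1 h.symm) ?_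
  · rw [← inv_inv z, h, inv_neg_one]
  · obtain ⟨D, hD⟩ : ∃ D, D = α * z + 1 := ⟨_, rfl⟩
    rw [← hD] at hz' ⊢
    field_simp
    rw [hD]
    linear_combination (1 - z ^ 2) ^ 2 * hα2

/-- With M(z) = (z + α)/(αz + 1), the composite of M, then w ↦ -α⁻²/w, then M is the translation by
α + α⁻¹: the middle map sends M(∞) = 1/α to the pole -1/α of M. The points where an intermediate
value is ∞ are treated apart. -/
theorem add_translation (hS : IsBalanced S) {α z : Qbar} (hα : (α : P1) ∈ baseHull)
    (hα2 : α ^ 2 + 2 * α - 1 = 0) (hz : (z : P1) ∈ S) : ((z + (α + α⁻¹) : Qbar) : P1) ∈ S := by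
  have hα0 : α ≠ 0 := by
    rintro rfl
    norm_num at hα2
  by_cases h1 : z + α = 0
  · rw [← add_assoc, h1, zero_add]
    exact hS.inv (hS.of_mem_baseHull hα)
  by_cases h2 : α * z + 1 = 0
  · have : z = -α⁻¹ := by
      field_simp
      linear_combination h2
    rw [this, add_comm, add_neg_cancel_right]
    exact hS.of_mem_baseHull hα
  have hB := isBalanced_baseHull
  have h3 := hS.smul (hB.neg (hB.smul (hB.inv hα) (hB.inv hα))) (hS.inv (hS.rotate hα hα2 hz h2))
  have hα1 : α ^ 2 - 1 ≠ 0 := by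
    intro h
    have : 2 * α = 0 := by linear_combination hα2 - h
    exact hα0 (by simpa using this)
  have h4 : α * (-(α⁻¹ * α⁻¹) * ((z + α) / (α * z + 1))⁻¹) + 1 ≠ 0 := by
    have : α * (-(α⁻¹ * α⁻¹) * ((z + α) / (α * z + 1))⁻¹) + 1 = (α ^ 2 - 1) / (α * (z + α)) := by
      field_simp
      ring
    rw [this]
    exact div_ne_zero hα1 (mul_ne_zero hα0 h1)
  convert hS.rotate hα hα2 h3 h4 using 2
  rw [eq_div_iff h4]
  field_simp
  ring

theorem add_one (hS : IsBalanced S) {z : Qbar} (hz : (z : P1) ∈ S) :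
    ((z + 1 : Qbar) : P1) ∈ S := by
  obtain ⟨α, hα, hα2⟩ := exists_translation
  have hα0 : α ≠ 0 := by
    rintro rfl
    norm_num at hα2
  have hB := isBalanced_baseHull
  have hτ := hB.add_translation hα hα2 hB.zero
  rw [zero_add] at hτ
  have hτ0 : α + α⁻¹ ≠ 0 := by
    intro h
    field_simp at h
    have h1 : α = 1 := by
      refine mul_left_cancel₀ (two_ne_zero (α := Qbar)) ?_
      linear_combination hα2 - h
    rw [h1] at h
    norm_num at h
  -- Conjugating the translation by τ = α + α⁻¹ with the homothety by τ gives z ↦ z + 1.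
  have := hS.smul (hB.inv hτ) (hS.add_translation hα hα2 (hS.smul hτ hz))
  rwa [← mul_add_one, inv_mul_cancel_left₀ hτ0] at this

theorem add_base (hS : IsBalanced S) {t z : Qbar} (ht : (t : P1) ∈ baseHull) (hz : (z : P1) ∈ S) :
    ((z + t : Qbar) : P1) ∈ S := by
  by_cases ht0 : t = 0
  · rwa [ht0, add_zero]
  have := hS.smul ht (hS.add_one (hS.smul (isBalanced_baseHull.inv ht) hz))
  rwa [mul_add, mul_inv_cancel_left₀ ht0, mul_one] at this

theorem two_mem_baseHull : ((2 : Qbar) : P1) ∈ baseHull := by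
  have h := isBalanced_baseHull
  rw [← one_add_one_eq_two]
  exact h.add_one h.one

theorem add_inv (hS : IsBalanced S) {z : Qbar} (hz : (z : P1) ∈ S) (hz0 : z ≠ 0) :
    ((z + z⁻¹ : Qbar) : P1) ∈ S := by
  have hB := isBalanced_baseHull
  have h2 := two_mem_baseHull
  have two : (2 : Qbar) ≠ 0 := two_ne_zero
  have main : ∀ w : Qbar, (w : P1) ∈ S → w ≠ 0 → ((2 * w - w⁻¹ : Qbar) : P1) ∈ S := by
    intro w hw hw0
    by_cases hw1 : w = 1
    · rw [hw1, inv_one, mul_one, show (2 : Qbar) - 1 = 1 by norm_num]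
      exact hS.one
    by_cases hw2 : w = -1
    · rw [hw2, inv_neg_one]
      convert hS.neg hS.one using 2
      ring
    have h1 := sub_ne_zero.mpr hw1
    have h1' : w + 1 ≠ 0 := fun h ↦ hw2 (eq_neg_of_add_eq_zero_left h)
    -- The branch points are chosen so that (c - a)(d - a) = (w + w⁻¹)² - 4 = (w - w⁻¹)² is a
    -- square.
    have := add_sqrt_mem hS.closed (a := w) (c := -w⁻¹ + 2) (d := -w⁻¹ + -2) (r := w - w⁻¹)
      hS.infty hw (hS.add_base h2 (hS.neg (hS.inv hw)))
      (hS.add_base (hB.neg h2) (hS.neg (hS.inv hw))) ?_ ?_ ?_ ?_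
    · convert this using 2
      ring
    · intro h
      refine pow_ne_zero 2 h1 ?_
      field_simp at h
      linear_combination h
    · intro h
      refine pow_ne_zero 2 h1' ?_
      field_simp at h
      linear_combination h
    · intro h
      have := add_left_cancel h
      exact two (self_eq_neg.mp this)
    · field_simp
      ring
  -- With k² = -1/2, `main` at kz gives 2k(z + z⁻¹).
  obtain ⟨k, hk⟩ := IsAlgClosed.exists_pow_nat_eq ((-1) * 2⁻¹ : Qbar) two_pos
  have hkm : (k : P1) ∈ baseHull := hB.sqrt_mul (hB.neg hB.one) (hB.inv h2) hk
  have hk0 : k ≠ 0 := by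
    rintro rfl
    norm_num at hk
  have := hS.smul (hB.inv (hB.smul h2 hkm)) (main (k * z) (hS.smul hkm hz) (mul_ne_zero hk0 hz0))
  convert this using 2
  field_simp
  rw [hk]
  ring

/-- For u = (a + 1)/(a - 1) one has u + u⁻¹ - 2 = 4/(a² - 1), and u = 1 + 2/(a - 1) is reached by
allowed operations. -/
theorem sq (hS : IsBalanced S) {a : Qbar} (ha : (a : P1) ∈ S) : ((a ^ 2 : Qbar) : P1) ∈ S := by
  by_cases h1 : a = 1
  · rw [h1, one_pow]
    exact hS.one
  by_cases h2 : a = -1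
  · rw [h2, neg_one_sq]
    exact hS.one
  have hB := isBalanced_baseHull
  have h1' := sub_ne_zero.mpr h1
  have h2' : a + 1 ≠ 0 := fun h ↦ h2 (eq_neg_of_add_eq_zero_left h)
  have htwo := two_mem_baseHull
  have hz := hS.add_one (hS.smul htwo (hS.inv (hS.add_base (hB.neg hB.one) ha)))
  have e1 : 2 * (a + -1)⁻¹ + 1 = (a + 1) / (a - 1) := by
    rw [← sub_eq_add_neg]
    field_simp
    ring
  rw [e1] at hz
  have hj := hS.add_inv hz (div_ne_zero h2' h1')
  have := hS.add_one (hS.smul (hB.smul htwo htwo) (hS.inv (hS.add_base (hB.neg htwo) hj)))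
  convert this using 2
  have e2 : (a + 1) / (a - 1) + ((a + 1) / (a - 1))⁻¹ + -2 = 4 / ((a + 1) * (a - 1)) := by
    field_simp
    ring
  rw [e2]
  field_simp
  ring

theorem mul (hS : IsBalanced S) {a b : Qbar} (ha : (a : P1) ∈ S) (hb : (b : P1) ∈ S) :
    ((a * b : Qbar) : P1) ∈ S := by
  obtain ⟨r, hr⟩ := IsAlgClosed.exists_pow_nat_eq (a * b) two_pos
  rw [← hr]
  exact hS.sq (hS.sqrt_mul ha hb hr)

theorem add (hS : IsBalanced S) {a b : Qbar} (ha : (a : P1) ∈ S) (hb : (b : P1) ∈ S) :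
    ((a + b : Qbar) : P1) ∈ S := by
  by_cases h : a = 0
  · rwa [h, zero_add]
  have := hS.mul ha (hS.add_one (hS.mul (hS.inv ha) hb))
  rwa [mul_add, mul_inv_cancel_left₀ h, mul_one, add_comm] at this

/-- The affine part of a balanced set is a field. -/
def affinePart (hS : IsBalanced S) : Subfield Qbar where
  carrier := {z | (z : P1) ∈ S}
  zero_mem' := hS.zero
  one_mem' := hS.one
  add_mem' := hS.add
  mul_mem' := hS.mul
  neg_mem' := hS.neg
  inv_mem' _ := hS.inv

end IsBalanced

/-! ### Equations of degree at most four over a field closed under square and cube roots. -/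

section Radicals

variable {F : Type*} [Field F] [IsAlgClosed F] [CharZero F] {K : Subfield F}

omit [IsAlgClosed F] in
theorem Subfield.mem_of_monic_quadratic (h2 : ∀ x : F, x ^ 2 ∈ K → x ∈ K) {b c z : F}
    (hb : b ∈ K) (hc : c ∈ K) (hz : z ^ 2 + b * z + c = 0) : z ∈ K := by
  have two : (2 : F) ≠ 0 := two_ne_zero
  have m2 : (2 : F) ∈ K := ofNat_mem K 2
  have h : z + b / 2 ∈ K := by
    refine h2 _ ?_
    have e : (z + b / 2) ^ 2 = (b / 2) ^ 2 - c := by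
      field_simp
      linear_combination 4 * hz
    rw [e]
    exact sub_mem (pow_mem (div_mem hb m2) 2) hc
  simpa using sub_mem h (div_mem hb m2)

theorem Subfield.mem_of_depressed_cubic (h2 : ∀ x : F, x ^ 2 ∈ K → x ∈ K)
    (h3 : ∀ x : F, x ^ 3 ∈ K → x ∈ K) {p q z : F} (hp : p ∈ K) (hq : q ∈ K)
    (hz : z ^ 3 + p * z + q = 0) : z ∈ K := by
  have m3 : (3 : F) ∈ K := ofNat_mem K 3
  have m27 : (27 : F) ∈ K := ofNat_mem K 27
  by_cases hp0 : p = 0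
  · refine h3 z ?_
    rw [show z ^ 3 = -q by linear_combination hz - z * hp0]
    exact neg_mem hq
  -- Cardano's substitution z = u - p/(3u), where u³ satisfies a quadratic over `K`.
  obtain ⟨s, hs⟩ := IsAlgClosed.exists_pow_nat_eq (z ^ 2 / 4 + p / 3) two_pos
  have hu : (z / 2 + s) ^ 2 - z * (z / 2 + s) - p / 3 = 0 := by linear_combination hs
  set u := z / 2 + s
  have hu0 : u ≠ 0 := by
    intro h
    rw [h] at hu
    apply hp0
    linear_combination -3 * hu
  have huz : z = u - p / (3 * u) := by
    field_simp
    linear_combination -3 * hu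
  have h6 : (u ^ 3) ^ 2 + q * u ^ 3 + -(p ^ 3 / 27) = 0 := by
    rw [huz] at hz
    field_simp at hz ⊢
    linear_combination hz
  have huK : u ∈ K := h3 u <| Subfield.mem_of_monic_quadratic h2 hq
    (neg_mem (div_mem (pow_mem hp 3) m27)) h6
  rw [huz]
  exact sub_mem huK (div_mem hp (mul_mem m3 huK))

theorem Subfield.mem_of_monic_cubic (h2 : ∀ x : F, x ^ 2 ∈ K → x ∈ K)
    (h3 : ∀ x : F, x ^ 3 ∈ K → x ∈ K) {b c d z : F} (hb : b ∈ K) (hc : c ∈ K) (hd : d ∈ K)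
    (hz : z ^ 3 + b * z ^ 2 + c * z + d = 0) : z ∈ K := by
  have m2 : (2 : F) ∈ K := ofNat_mem K 2
  have m3 : (3 : F) ∈ K := ofNat_mem K 3
  have m27 : (27 : F) ∈ K := ofNat_mem K 27
  have h : z + b / 3 ∈ K := by
    refine Subfield.mem_of_depressed_cubic h2 h3 (p := c - b ^ 2 / 3)
      (q := 2 * b ^ 3 / 27 - b * c / 3 + d) ?_ ?_ ?_
    · exact sub_mem hc (div_mem (pow_mem hb 2) m3)
    · exact add_mem (sub_mem (div_mem (mul_mem m2 (pow_mem hb 3)) m27)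
        (div_mem (mul_mem hb hc) m3)) hd
    · linear_combination hz
  simpa using sub_mem h (div_mem hb m3)

/-- Ferrari's method: a root y of the resolvent cubic and m = √(y - p) split the quartic into two
quadratics over `K`; m = 0 is the biquadratic case. -/
theorem Subfield.mem_of_depressed_quartic (h2 : ∀ x : F, x ^ 2 ∈ K → x ∈ K)
    (h3 : ∀ x : F, x ^ 3 ∈ K → x ∈ K) {p q r z : F} (hp : p ∈ K) (hq : q ∈ K) (hr : r ∈ K)
    (hz : z ^ 4 + p * z ^ 2 + q * z + r = 0) : z ∈ K := by
  have m2 : (2 : F) ∈ K := ofNat_mem K 2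
  have m4 : (4 : F) ∈ K := ofNat_mem K 4
  obtain ⟨y, hy⟩ : ∃ y : F, y ^ 3 + -p * y ^ 2 + -(4 * r) * y + (4 * p * r - q ^ 2) = 0 := by
    have := IsAlgClosed.exists_root (Cubic.toPoly
      ⟨1, -p, -(4 * r), 4 * p * r - q ^ 2⟩) (by
        rw [Cubic.degree_of_a_ne_zero one_ne_zero]
        norm_num)
    obtain ⟨y, hy⟩ := this
    refine ⟨y, ?_⟩
    simpa [Cubic.toPoly, Polynomial.IsRoot] using hy
  have hyK : y ∈ K := Subfield.mem_of_monic_cubic h2 h3 (neg_mem hp) (neg_mem (mul_mem m4 hr))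
    (sub_mem (mul_mem (mul_mem m4 hp) hr) (pow_mem hq 2)) hy
  obtain ⟨m, hm⟩ := IsAlgClosed.exists_pow_nat_eq (y - p) two_pos
  have hmK : m ∈ K := h2 m (hm ▸ sub_mem hyK hp)
  by_cases hm0 : m = 0
  · have hyp : y = p := by
      rw [hm0] at hm
      linear_combination -hm
    have hq0 : q = 0 := by
      rw [hyp] at hy
      refine pow_eq_zero_iff two_ne_zero |>.mp ?_
      linear_combination -hy
    refine h2 z (Subfield.mem_of_monic_quadratic h2 hp hr ?_)
    linear_combination hz - z * hq0
  have hprod : (z ^ 2 + -m * z + (y / 2 + q / (2 * m))) *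
      (z ^ 2 + m * z + (y / 2 - q / (2 * m))) = 0 := by
    have e : (y / 2) ^ 2 - (q / (2 * m)) ^ 2 = r := by
      field_simp
      rw [hm]
      linear_combination hy
    have e' : 2 * m * (q / (2 * m)) = q := mul_div_cancel₀ _ (mul_ne_zero two_ne_zero hm0)
    linear_combination hz - z ^ 2 * hm + e + z * e'
  have hqm := div_mem hq (mul_mem m2 hmK)
  have hy2 := div_mem hyK m2
  rcases mul_eq_zero.mp hprod with h | h
  · exact Subfield.mem_of_monic_quadratic h2 (neg_mem hmK) (add_mem hy2 hqm) h
  · exact Subfield.mem_of_monic_quadratic h2 hmK (sub_mem hy2 hqm) h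

theorem Subfield.mem_of_monic_quartic (h2 : ∀ x : F, x ^ 2 ∈ K → x ∈ K)
    (h3 : ∀ x : F, x ^ 3 ∈ K → x ∈ K) {b c d e z : F} (hb : b ∈ K) (hc : c ∈ K) (hd : d ∈ K)
    (he : e ∈ K) (hz : z ^ 4 + b * z ^ 3 + c * z ^ 2 + d * z + e = 0) : z ∈ K := by
  have m2 : (2 : F) ∈ K := ofNat_mem K 2
  have m3 : (3 : F) ∈ K := ofNat_mem K 3
  have m4 : (4 : F) ∈ K := ofNat_mem K 4
  have m6 : (6 : F) ∈ K := ofNat_mem K 6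
  have hb4 := div_mem hb m4
  set B := b / 4 with hB
  have hbB : b = 4 * B := by rw [hB]; field_simp
  have h : z + B ∈ K := by
    refine Subfield.mem_of_depressed_quartic h2 h3 (p := c - 6 * B ^ 2)
      (q := d - 2 * B * c + (2 * B) ^ 3) (r := e - B * d + B ^ 2 * c - 3 * B ^ 4) ?_ ?_ ?_ ?_
    · exact sub_mem hc (mul_mem m6 (pow_mem hb4 2))
    · exact add_mem (sub_mem hd (mul_mem (mul_mem m2 hb4) hc)) (pow_mem (mul_mem m2 hb4) 3)
    · exact sub_mem (add_mem (sub_mem he (mul_mem hb4 hd)) (mul_mem (pow_mem hb4 2) hc))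
        (mul_mem m3 (pow_mem hb4 4))
    · linear_combination hz - z ^ 3 * hbB
  simpa using sub_mem h hb4

theorem Subfield.mem_of_root (h2 : ∀ x : F, x ^ 2 ∈ K → x ∈ K)
    (h3 : ∀ x : F, x ^ 3 ∈ K → x ∈ K) {p : Polynomial F}
    (hdeg : p.natDegree = 2 ∨ p.natDegree = 3 ∨ p.natDegree = 4)
    (hcoeff : ∀ i ≤ p.natDegree, p.coeff i ∈ K) {z : F} (hz : p.eval z = 0) : z ∈ K := by
  have hp : p ≠ 0 := by
    rintro rfl
    simp at hdeg
  have hl : p.coeff p.natDegree ≠ 0 := Polynomial.leadingCoeff_ne_zero.mpr hp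
  have hmem : ∀ i ≤ p.natDegree, p.coeff i / p.coeff p.natDegree ∈ K := fun i hi ↦
    div_mem (hcoeff i hi) (hcoeff _ le_rfl)
  rw [Polynomial.eval_eq_sum_range] at hz
  rcases hdeg with h | h | h <;> rw [h] at hz hl hmem <;> simp only [Finset.sum_range_succ,
    Finset.sum_range_zero] at hz
  · refine Subfield.mem_of_monic_quadratic h2 (hmem 1 (by norm_num)) (hmem 0 (by norm_num)) ?_
    field_simp
    linear_combination hz
  · refine Subfield.mem_of_monic_cubic h2 h3 (hmem 2 (by norm_num)) (hmem 1 (by norm_num))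
      (hmem 0 (by norm_num)) ?_
    field_simp
    linear_combination hz
  · refine Subfield.mem_of_monic_quartic h2 h3 (hmem 3 (by norm_num)) (hmem 2 (by norm_num))
      (hmem 1 (by norm_num)) (hmem 0 (by norm_num)) ?_
    field_simp
    linear_combination hz

/-- A monic quartic over an algebraically closed field is a product of linear factors. -/
theorem IsAlgClosed.exists_quartic_roots (b c d e : F) : ∃ x₁ x₂ x₃ x₄ : F,
    b = -(x₁ + x₂ + x₃ + x₄) ∧
    c = x₁ * x₂ + x₁ * x₃ + x₁ * x₄ + x₂ * x₃ + x₂ * x₄ + x₃ * x₄ ∧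
    d = -(x₁ * x₂ * x₃ + x₁ * x₂ * x₄ + x₁ * x₃ * x₄ + x₂ * x₃ * x₄) ∧
    e = x₁ * x₂ * x₃ * x₄ := by
  open Polynomial in
  obtain ⟨x, hx⟩ := IsAlgClosed.exists_root
    (X ^ 4 + C b * X ^ 3 + C c * X ^ 2 + C d * X + C e : F[X]) (by
      rw [show (X ^ 4 + C b * X ^ 3 + C c * X ^ 2 + C d * X + C e : F[X]).degree = 4 by
        compute_degree!]
      norm_num)
  simp only [Polynomial.IsRoot, Polynomial.eval_add, Polynomial.eval_mul, Polynomial.eval_pow,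
    Polynomial.eval_X, Polynomial.eval_C] at hx
  -- The cubic is the quotient of the quartic by X - x.
  have h3 : (Cubic.toPoly ⟨1, b + x, c + b * x + x ^ 2, d + c * x + b * x ^ 2 + x ^ 3⟩ :
      Polynomial F).Splits := IsAlgClosed.splits _
  have h := (Cubic.splits_iff_roots_eq_three (F := F) (φ := RingHom.id F)
    (P := ⟨1, b + x, c + b * x + x ^ 2, d + c * x + b * x ^ 2 + x ^ 3⟩) one_ne_zero).mp
    (by simpa using h3)
  obtain ⟨x₂, x₃, x₄, h⟩ := h
  have hb := Cubic.b_eq_three_roots one_ne_zero h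
  have hc := Cubic.c_eq_three_roots one_ne_zero h
  have hd := Cubic.d_eq_three_roots one_ne_zero h
  simp only [RingHom.id_apply, one_mul] at hb hc hd
  refine ⟨x, x₂, x₃, x₄, ?_, ?_, ?_, ?_⟩
  · linear_combination hb
  · linear_combination hc - x * hb
  · linear_combination hd - x * hc
  · linear_combination hx - x * hd

omit [IsAlgClosed F] [CharZero F] in
theorem quartic_resolvent {b c d e x₁ x₂ x₃ x₄ : F} (hb : b = -(x₁ + x₂ + x₃ + x₄))
    (hc : c = x₁ * x₂ + x₁ * x₃ + x₁ * x₄ + x₂ * x₃ + x₂ * x₄ + x₃ * x₄)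
    (hd : d = -(x₁ * x₂ * x₃ + x₁ * x₂ * x₄ + x₁ * x₃ * x₄ + x₂ * x₃ * x₄))
    (he : e = x₁ * x₂ * x₃ * x₄) :
    (x₁ * x₂ + x₃ * x₄) ^ 3 - c * (x₁ * x₂ + x₃ * x₄) ^ 2
      + (b * d - 4 * e) * (x₁ * x₂ + x₃ * x₄) - (d ^ 2 + b ^ 2 * e - 4 * c * e) = 0 := by
  rw [hb, hc, hd, he]
  ring

end Radicals

/-! ### Cube roots from 3-torsion. -/

namespace IsBalanced

variable {S : Set P1}

theorem mem_affinePart_of_sq (hS : IsBalanced S) {x : Qbar} (hx : x ^ 2 ∈ hS.affinePart) :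
    x ∈ hS.affinePart :=
  hS.sqrt_mul hx hS.one (mul_one _).symm

/-- Some cube root is obtained from the `3`-torsion of `y² = x (x - 1) (x - l)`, whose
discriminant is `(4 l (1 - l)) ^ 2`. -/
theorem exists_cube_root (hS : IsBalanced S) {t : Qbar} (ht : t ∈ hS.affinePart) (ht0 : t ≠ 0) :
    ∃ w ∈ hS.affinePart, w ^ 3 = t := by
  obtain ⟨μ, hμ⟩ := IsAlgClosed.exists_pow_nat_eq t two_pos
  have hμK : μ ∈ hS.affinePart := hS.mem_affinePart_of_sq (hμ ▸ ht)
  have hμ0 : μ ≠ 0 := by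
    rintro rfl
    exact ht0 (by rw [← hμ, zero_pow two_ne_zero])
  have n (k : ℕ) [k.AtLeastTwo] : (OfNat.ofNat k : Qbar) ∈ hS.affinePart := ofNat_mem _ k
  obtain ⟨ν, hν⟩ := IsAlgClosed.exists_pow_nat_eq (1 - μ) two_pos
  have hνK : ν ∈ hS.affinePart := hS.mem_affinePart_of_sq (hν ▸ sub_mem (one_mem _) hμK)
  -- The parameter l is chosen so that the discriminant (4l(1 - l))² equals μ² = t.
  obtain ⟨l, hlK, hl⟩ : ∃ l ∈ hS.affinePart, 4 * (l * (1 - l)) = μ :=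
    ⟨(1 + ν) / 2, div_mem (add_mem (one_mem _) hνK) (n 2), by linear_combination -hν⟩
  have hl0 : l ≠ 0 := by
    rintro rfl
    exact hμ0 (by rw [← hl]; ring)
  have hl1 : l ≠ 1 := by
    rintro rfl
    exact hμ0 (by rw [← hl]; ring)
  obtain ⟨x₁, x₂, x₃, x₄, h1, h2, h3, h4⟩ := IsAlgClosed.exists_quartic_roots
    (-(4 * (1 + l) / 3)) (2 * l) 0 (-(l ^ 2 / 3))
  have hroot : ∀ x : Qbar, (x - x₁) * (x - x₂) * (x - x₃) * (x - x₄) = 0 →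
      x ∈ hS.affinePart := fun x hx ↦
    three_torsion_mem hS.closed hS.infty hS.zero hS.one hlK hl0 hl1 (by
      linear_combination 3 * hx + 3 * x ^ 3 * h1 + 3 * x ^ 2 * h2 + 3 * x * h3 + 3 * h4)
  have m1 := hroot x₁ (by ring)
  have m2 := hroot x₂ (by ring)
  have m3 := hroot x₃ (by ring)
  have m4 := hroot x₄ (by ring)
  -- Centred at 2l/3, the resolvent cubic becomes pure: (y - 2l/3)³ = -16 l²(1 - l)²/27.
  refine ⟨-3 * (x₁ * x₂ + x₃ * x₄ - 2 * l / 3), ?_, ?_⟩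
  · exact mul_mem (neg_mem (n 3)) (sub_mem (add_mem (mul_mem m1 m2) (mul_mem m3 m4))
      (div_mem (mul_mem (n 2) hlK) (n 3)))
  · set y := x₁ * x₂ + x₃ * x₄ with hy
    have hres : y ^ 3 - (2 * l) * y ^ 2 - 4 * (-(l ^ 2 / 3)) * y
        - ((-(4 * (1 + l) / 3)) ^ 2 * (-(l ^ 2 / 3)) - 4 * (2 * l) * (-(l ^ 2 / 3))) = 0 := by
      have hres' := quartic_resolvent h1 h2 h3 h4
      rw [← hy] at hres'
      linear_combination hres'
    rw [← hμ, ← hl]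
    linear_combination -27 * hres

theorem mem_affinePart_of_cube (hS : IsBalanced S) {x : Qbar} (hx : x ^ 3 ∈ hS.affinePart) :
    x ∈ hS.affinePart := by
  by_cases hx0 : x = 0
  · rw [hx0]
    exact zero_mem _
  obtain ⟨w, hw, hwx⟩ := hS.exists_cube_root hx (pow_ne_zero 3 hx0)
  -- The other cube roots are quadratic over the field, so closure under square roots captures them.
  have h : (x - w) * (x ^ 2 + w * x + w ^ 2) = 0 := by linear_combination -hwx
  rcases mul_eq_zero.mp h with h | h
  · rwa [sub_eq_zero.mp h]
  · exact Subfield.mem_of_monic_quadratic (fun _ ↦ hS.mem_affinePart_of_sq) hw (pow_mem hw 2) h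

end IsBalanced

/-- For `δ ∉ {0, ∞, ±1, ±i}`, every polynomial of degree two, three or four with coefficients in
`L_δ \ {∞}` has all its roots, counted with multiplicity, in `L_δ \ {∞}`. -/
theorem corollary7 (δ : Qbar) (hδ0 : δ ≠ 0) (hδ4 : δ ^ 4 ≠ 1)
    (p : Polynomial Qbar) (hdeg : p.natDegree = 2 ∨ p.natDegree = 3 ∨ p.natDegree = 4)
    (hcoeff : ∀ i ≤ p.natDegree, ((p.coeff i : Qbar) : P1) ∈ LDelta δ \ {OnePoint.infty}) :
    p.roots.card = p.natDegree ∧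
      ∀ z ∈ p.roots, (z : P1) ∈ LDelta δ \ {OnePoint.infty} := by
  have hS := isBalanced_LDelta hδ0 hδ4
  refine ⟨(IsAlgClosed.splits p).natDegree_eq_card_roots.symm, fun z hz ↦
    ⟨?_, OnePoint.coe_ne_infty z⟩⟩
  exact Subfield.mem_of_root (K := hS.affinePart) (fun _ ↦ hS.mem_affinePart_of_sq)
    (fun _ ↦ hS.mem_affinePart_of_cube) hdeg (fun i hi ↦ (hcoeff i hi).1)
    (Polynomial.isRoot_of_mem_roots hz)
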